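/- Let $\Gamma$ be a finite simplicial graph whose edges are labelled by integers $\geq 2$, and let $G = G_\Gamma$ be its Artin group: the generators are the vertices of $\Gamma$, and for each edge with vertices $u,v$ and label $n$ there is the relation $\underbrace{uvu\cdots}_{n}=\underbrace{vuv\cdots}_{n}$. Assume that all labels are even and that every cycle of $\Gamma$ (closed path of length at least $3$ without repeated vertices apart from its equal end points) whose labels are all greater than $2$ has odd length. Let $S(G)$ be the set of classes $[\chi]=\mathbb{R}_{>0}\chi$ of non-zero homomorphisms $\chi: G\to\mathbb{R}$, and let $\Sigma^1(G)\subseteq S(G)$ be the set of those $[\chi]$ for which, in the Cayley graph of $G$ with respect to a finite generating set (with edges joining $g$ and $gs$, $s$ a generator), the subgraph spanned by the vertices $g$ with $\chi(g)\geq 0$ is connected. For a non-zero character $\chi$, call an edge of $\Gamma$ with vertices $u,v$ dead if $\chi(u)=-\chi(v)$ and its label is even and greater than $2$. Let $\mathcal{L}(\chi)$, the living subgraph, be obtained from the full subgraph of $\Gamma$ on the vertices $v$ with $\chi(v)\neq 0$ by removing all dead edges. A subgraph $\Gamma_0$ of $\Gamma$ is dominant if each vertex of $\Gamma$ outside $\Gamma_0$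 is linked by an edge of $\Gamma$ to a vertex of $\Gamma_0$. Then $$\Sigma^1(G)=\{[\chi]\in S(G) \mid \mathcal{L}(\chi) \text{ is a connected dominant subgraph of } \Gamma\}.$$ -/

import Mathlib

/-! ### Real characters, the character sphere and `Σ¹` -/

/-- Real characters of a group `G`, i.e. homomorphisms from `G` to `(ℝ, +)`. They form a real
vector space. -/
abbrev RealCharacter (G : Type*) [Group G] : Type _ := Additive G →+ ℝ

/-- The value of the character `χ` at the group element `g`. -/
def RealCharacter.val {G : Type*} [Group G] (χ : RealCharacter G) (g : G) : ℝ :=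
  χ (Additive.ofMul g)

/-- The character sphere `S(G)`: the nonzero real characters modulo multiplication by positive real
numbers. -/
abbrev CharacterSphere (G : Type*) [Group G] : Type _ := Module.Ray ℝ (RealCharacter G)

/-- The condition defining `Σ¹`: for the Cayley graph of `G` with respect to some finite
generating set, the subgraph spanned by the vertices `g` with `χ(g) ≥ 0` is connected. -/
def HasConnectedHalfCayley {G : Type*} [Group G] (χ : RealCharacter G) : Prop :=
  ∃ S : Finset G, Subgroup.closure (S : Set G) = ⊤ ∧
    ((SimpleGraph.mulCayley (S : Set G)).induce {g : G | 0 ≤ χ.val g}).Connected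

/-- The Bieri–Neumann–Strebel invariant `Σ¹(G)`, as a set of classes `[χ]` in `S(G)`. -/
def sigmaOne (G : Type*) [Group G] : Set (CharacterSphere G) :=
  {c | ∃ (χ : RealCharacter G) (hχ : χ ≠ 0),
    c = rayOfNeZero ℝ χ hχ ∧ HasConnectedHalfCayley χ}

/-- The condition defining `Σ¹` only depends on the class of the character. -/
theorem hasConnectedHalfCayley_smul {G : Type*} [Group G] (χ : RealCharacter G) (r : ℝ)
    (hr : 0 < r) : HasConnectedHalfCayley (r • χ) ↔ HasConnectedHalfCayley χ := by
  have h : {g : G | 0 ≤ RealCharacter.val (r • χ) g} = {g : G | 0 ≤ RealCharacter.val χ g} := by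
    ext g
    simp [RealCharacter.val, hr]
  unfold HasConnectedHalfCayley
  rw [h]

/-! ### Labelled graphs and Artin groups -/

/-- A simplicial graph with vertex set `V` whose edges are labelled by integers greater than one
(the values of `label` off the edges play no role). -/
structure LabelledGraph (V : Type*) where
  graph : SimpleGraph V
  label : Sym2 V → ℕ
  two_le_label : ∀ e ∈ graph.edgeSet, 2 ≤ label e

/-- The alternating product `a b a ⋯` with `n` factors. -/
def alternatingProd {M : Type*} [Monoid M] (a b : M) : ℕ → M
  | 0 => 1
  | n + 1 => a * alternatingProd b a n

namespace LabelledGraph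

variable {V : Type*} (Γ : LabelledGraph V)

/-- The Artin relators `(u v u ⋯)(v u v ⋯)⁻¹`, one for each (oriented) edge `u v` of `Γ`, with as
many factors in each alternating product as the label of the edge says. -/
def artinRelators : Set (FreeGroup V) :=
  {r | ∃ u v : V, Γ.graph.Adj u v ∧
    r = alternatingProd (FreeGroup.of u) (FreeGroup.of v) (Γ.label s(u, v)) *
      (alternatingProd (FreeGroup.of v) (FreeGroup.of u) (Γ.label s(u, v)))⁻¹}

/-- The Artin group `G_Γ`. -/
abbrev ArtinGroup : Type _ := PresentedGroup Γ.artinRelators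

/-- The value of a character of `G_Γ` on the generator `v`. -/
def vertexValue (χ : RealCharacter Γ.ArtinGroup) (v : V) : ℝ :=
  χ.val (PresentedGroup.of v)

/-- `Γ` is even if all its labels are even. -/
def IsEven : Prop := ∀ e ∈ Γ.graph.edgeSet, Even (Γ.label e)

/-- The dead edges of `Γ` with respect to `χ`. -/
def deadEdges (χ : RealCharacter Γ.ArtinGroup) : Set (Sym2 V) :=
  {e | ∃ u v : V, e = s(u, v) ∧ Γ.graph.Adj u v ∧
    Γ.vertexValue χ u = -Γ.vertexValue χ v ∧ Even (Γ.label e) ∧ 2 < Γ.label e}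

/-- The full subgraph of `Γ` on the vertices where `χ` does not vanish. -/
def fullLivingSubgraph (χ : RealCharacter Γ.ArtinGroup) : Γ.graph.Subgraph :=
  (⊤ : Γ.graph.Subgraph).induce {v | Γ.vertexValue χ v ≠ 0}

/-- The living subgraph `L(χ)`: the previous subgraph without its dead edges. -/
def livingSubgraph (χ : RealCharacter Γ.ArtinGroup) : Γ.graph.Subgraph :=
  (Γ.fullLivingSubgraph χ).deleteEdges (Γ.deadEdges χ)

/-- A subgraph `H` of `Γ` is dominant if every vertex of `Γ` outside `H` is linked by an edge of
`Γ` to a vertex of `H`. -/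
def IsDominant (H : Γ.graph.Subgraph) : Prop :=
  ∀ v : V, v ∉ H.verts → ∃ w ∈ H.verts, Γ.graph.Adj v w

end LabelledGraph

/-! Sufficiency: for an edge `uv` of even label `n`, the element `z = (uv)^(n/2)` commutes with `u`
and `v`, and `χ(z) = (n/2)(χ(u) + χ(v))`. The ends of a living edge thus commute with each other or
with a common `z` having `χ(z) ≠ 0`, and a vertex killed by `χ` commutes with the `z` of an edge to
a living vertex. `hasConnectedHalfCayley_of_commute` turns such commutation chains into paths in the
half space.

Necessity: let `G` act on functions `ℝ → ℂ` by affine maps whose linear parts are scaled shifts by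
`χ`. If the half space is connected, its orbit of `0` has support uniformly bounded below
(`HasConnectedHalfCayley.exists_forall_eq_zero`). When the living subgraph is disconnected, one
component acts by homotheties centred at the delta function `δ` at `0`, the other living vertices by
homotheties centred at `0`; commutators then violate the bound. Across a dead edge the Artin
relation holds once the two scalars multiply to a suitable root of unity. The parity hypothesis
makes the dead edges a forest, where such scalars exist. When dominance fails, a translation by `δ`
plays the same role. -/

namespace RealCharacter

variable {G : Type*} [Group G] (χ : RealCharacter G)

@[simp]
theorem val_one : χ.val 1 = 0 := map_zero χ

@[simp]
theorem val_mul (g h : G) : χ.val (g * h) = χ.val g + χ.val h := map_add χ _ _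

@[simp]
theorem val_inv (g : G) : χ.val g⁻¹ = -χ.val g := map_neg χ _

@[simp]
theorem val_pow (g : G) (n : ℕ) : χ.val (g ^ n) = n * χ.val g := by
  induction n with
  | zero => simp
  | succ n ih => rw [pow_succ, val_mul, ih]; push_cast; ring

theorem val_mul_pow_eventually_nonneg {t : G} (ht : 0 < χ.val t) (g : G) :
    ∀ᶠ n : ℕ in Filter.atTop, 0 ≤ χ.val (g * t ^ n) := by
  have h := (tendsto_natCast_atTop_atTop (R := ℝ)).atTop_mul_const ht
  filter_upwards [h.eventually_ge_atTop (-χ.val g)] with n hn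
  rw [val_mul, val_pow]
  linarith

end RealCharacter

/-! ### Connected half spaces from commuting elements -/

section Sufficiency

variable {G : Type*} [Group G]

/-- `g` and `h` lie in the half space `χ ≥ 0` and can be joined inside it by a path in the Cayley
graph with respect to `S`. -/
def HalfSpaceJoined (χ : RealCharacter G) (S : Set G) (g h : G) : Prop :=
  ∃ (hg : 0 ≤ χ.val g) (hh : 0 ≤ χ.val h),
    ((SimpleGraph.mulCayley S).induce {g : G | 0 ≤ χ.val g}).Reachable ⟨g, hg⟩ ⟨h, hh⟩

namespace HalfSpaceJoined

variable {χ : RealCharacter G} {S : Set G}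

theorem refl {g : G} (hg : 0 ≤ χ.val g) : HalfSpaceJoined χ S g g := ⟨hg, hg, .refl _⟩

theorem symm {g h : G} : HalfSpaceJoined χ S g h → HalfSpaceJoined χ S h g :=
  fun ⟨hg, hh, p⟩ ↦ ⟨hh, hg, p.symm⟩

theorem trans {g h k : G} :
    HalfSpaceJoined χ S g h → HalfSpaceJoined χ S h k → HalfSpaceJoined χ S g k :=
  fun ⟨hg, _, p⟩ ⟨_, hk, q⟩ ↦ ⟨hg, hk, p.trans q⟩

theorem mul_right {g s : G} (hs : s ∈ S ∨ s⁻¹ ∈ S) (hg : 0 ≤ χ.val g)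
    (hgs : 0 ≤ χ.val (g * s)) : HalfSpaceJoined χ S g (g * s) := by
  by_cases h : g = g * s
  · rw [← h]
    exact refl hg
  refine ⟨hg, hgs, SimpleGraph.Adj.reachable ?_⟩
  rw [SimpleGraph.induce_adj, SimpleGraph.mulCayley_adj']
  refine ⟨h, ?_⟩
  rcases hs with hs | hs
  · exact ⟨s, hs, Or.inl rfl⟩
  · exact ⟨s⁻¹, hs, Or.inr (by simp)⟩

theorem mul_pow {g t : G} (ht : t ∈ S ∨ t⁻¹ ∈ S) (htχ : 0 < χ.val t) (hg : 0 ≤ χ.val g)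
    (n : ℕ) : HalfSpaceJoined χ S g (g * t ^ n) := by
  induction n with
  | zero => simpa using refl hg
  | succ n ih =>
    obtain ⟨-, hn, -⟩ := id ih
    refine ih.trans ?_
    rw [pow_succ, ← mul_assoc]
    refine mul_right ht hn ?_
    rw [RealCharacter.val_mul]
    linarith

end HalfSpaceJoined

/-- The rays `g t ^ n` and `h u ^ n` end up in the same component of the half space `χ ≥ 0`. -/
def RaysJoined (χ : RealCharacter G) (S : Set G) (t u g h : G) : Prop :=
  ∀ n m : ℕ, 0 ≤ χ.val (g * t ^ n) → 0 ≤ χ.val (h * u ^ m) →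
    HalfSpaceJoined χ S (g * t ^ n) (h * u ^ m)

namespace RaysJoined

variable {χ : RealCharacter G} {S : Set G}

theorem trans {t u w g h k : G} (hu : 0 < χ.val u) (h₁ : RaysJoined χ S t u g h)
    (h₂ : RaysJoined χ S u w h k) : RaysJoined χ S t w g k := by
  intro n m hn hm
  obtain ⟨l, hl⟩ := (χ.val_mul_pow_eventually_nonneg hu h).exists
  exact (h₁ n l hn hl).trans (h₂ l m hl hm)

theorem symm {t u g h : G} (H : RaysJoined χ S t u g h) : RaysJoined χ S u t h g :=
  fun n m hn hm ↦ (H m n hm hn).symm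

/-- Both rays lead, moving upwards, to `g t^n u^m = g u^m t^n`. -/
theorem of_commute {t u : G} (htS : t ∈ S ∨ t⁻¹ ∈ S) (huS : u ∈ S ∨ u⁻¹ ∈ S)
    (ht : 0 < χ.val t) (hu : 0 < χ.val u) (h : Commute t u) (g : G) :
    RaysJoined χ S t u g g := by
  intro n m hn hm
  have h₁ := HalfSpaceJoined.mul_pow huS hu hn m
  have h₂ := HalfSpaceJoined.mul_pow htS ht hm n
  rw [mul_assoc, (h.pow_pow n m).eq, ← mul_assoc] at h₁
  exact h₁.trans h₂.symm

/-- High enough on the rays, `g t^k s = g s t^k` is one edge inside the half space, whatever the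
sign of `χ(s)`. -/
theorem mul_right_of_commute {t s : G} (htS : t ∈ S ∨ t⁻¹ ∈ S) (hs : s ∈ S)
    (ht : 0 < χ.val t) (h : Commute s t) (g : G) : RaysJoined χ S t t g (g * s) := by
  intro n m hn hm
  obtain ⟨k, hk₁, hk₂⟩ := ((χ.val_mul_pow_eventually_nonneg ht g).and
    (χ.val_mul_pow_eventually_nonneg ht (g * s))).exists
  have hedge : HalfSpaceJoined χ S (g * t ^ k) (g * s * t ^ k) := by
    have e : g * s * t ^ k = g * t ^ k * s := by
      rw [mul_assoc, (h.pow_right k).eq, mul_assoc]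
    rw [e] at hk₂ ⊢
    exact HalfSpaceJoined.mul_right (Or.inl hs) hk₁ hk₂
  exact ((of_commute htS htS ht ht (.refl t) g n k hn hk₁).trans hedge).trans
    (of_commute htS htS ht ht (.refl t) (g * s) k m hk₂ hm)

end RaysJoined

/-- A character is in `Σ¹` as soon as there is a finite set `T` of group elements with nonzero
character value whose commuting graph is connected and such that every generator commutes with a
member of `T`. -/
theorem hasConnectedHalfCayley_of_commute (χ : RealCharacter G) (S T : Finset G)
    (hS : Subgroup.closure (S : Set G) = ⊤) (hT : T.Nonempty) (hTχ : ∀ t ∈ T, χ.val t ≠ 0)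
    (hconn : ∀ t ∈ T, ∀ u ∈ T, Relation.ReflTransGen (fun x y ↦ y ∈ T ∧ Commute x y) t u)
    (hdom : ∀ s ∈ S, ∃ t ∈ T, Commute s t) : HasConnectedHalfCayley χ := by
  classical
  set pos : G → G := fun t ↦ if 0 < χ.val t then t else t⁻¹ with hpos
  have pos_pos : ∀ t ∈ T, 0 < χ.val (pos t) := by
    intro t ht
    simp only [hpos]
    split_ifs with h
    · exact h
    · rw [RealCharacter.val_inv]
      exact neg_pos.2 (lt_of_le_of_ne (not_lt.1 h) (hTχ t ht))
  have pos_mem : ∀ t ∈ T, pos t ∈ (↑(S ∪ T) : Set G) ∨ (pos t)⁻¹ ∈ (↑(S ∪ T) : Set G) := by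
    intro t ht
    simp only [hpos]
    split_ifs <;> simp [ht]
  have commute_pos : ∀ x t : G, Commute x t → Commute x (pos t) := by
    intro x t h
    simp only [hpos]
    split_ifs
    · exact h
    · exact h.inv_right
  have rays : ∀ t ∈ T, ∀ u ∈ T, ∀ g, RaysJoined χ ↑(S ∪ T) (pos t) (pos u) g g := by
    intro t ht u hu g
    have h : u ∈ T ∧ RaysJoined χ ↑(S ∪ T) (pos t) (pos u) g g := by
      have hR := hconn t ht u hu
      clear hu
      induction hR with
      | refl =>
        exact ⟨ht, .of_commute (pos_mem t ht) (pos_mem t ht) (pos_pos t ht) (pos_pos t ht)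
          (.refl _) g⟩
      | tail _ h ih =>
        obtain ⟨hx, ih⟩ := ih
        refine ⟨h.1, ih.trans (pos_pos _ hx) (.of_commute (pos_mem _ hx) (pos_mem _ h.1)
          (pos_pos _ hx) (pos_pos _ h.1) ?_ g)⟩
        exact commute_pos _ _ (commute_pos _ _ h.2.symm).symm
    exact h.2
  obtain ⟨t, ht⟩ := hT
  -- With `g` arbitrary, the statement is closed under products and inverses of `k`.
  have all : ∀ k g : G, RaysJoined χ ↑(S ∪ T) (pos t) (pos t) g (g * k) := by
    intro k
    have hk : k ∈ Subgroup.closure (S : Set G) := hS ▸ Subgroup.mem_top k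
    induction hk using Subgroup.closure_induction with
    | mem s hs =>
      intro g
      obtain ⟨u, hu, hsu⟩ := hdom s hs
      exact ((rays t ht u hu g).trans (pos_pos u hu) (.mul_right_of_commute (pos_mem u hu)
        (by simp [Finset.mem_coe.1 hs]) (pos_pos u hu) (commute_pos _ _ hsu) g)).trans
        (pos_pos u hu) (rays u hu t ht _)
    | one => simpa using rays t ht t ht
    | mul x y _ _ hx hy =>
      intro g
      rw [← mul_assoc]
      exact (hx g).trans (pos_pos t ht) (hy _)
    | inv x _ hx =>
      intro g
      simpa using (hx (g * x⁻¹)).symm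
  -- The elements of `T` join the generating set, so that moving along a ray follows edges.
  refine ⟨S ∪ T, ?_, ?_⟩
  · rw [eq_top_iff, ← hS]
    exact Subgroup.closure_mono (by simp)
  · have : Nonempty {g : G | 0 ≤ χ.val g} := ⟨⟨1, by simp⟩⟩
    refine ⟨fun ⟨g, hg⟩ ⟨h, hh⟩ ↦ ?_⟩
    obtain ⟨_, _, p⟩ := all (g⁻¹ * h) g 0 0 (by simpa using hg) (by simpa using hh)
    simpa using p

end Sufficiency

/-! ### Central elements of even edges and the living subgraph -/

theorem alternatingProd_two_mul {M : Type*} [Monoid M] (a b : M) (m : ℕ) :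
    alternatingProd a b (2 * m) = (a * b) ^ m := by
  induction m with
  | zero => exact (pow_zero _).symm
  | succ m ih => rw [mul_add, pow_succ', ← ih, mul_assoc]; rfl

theorem map_alternatingProd {M N : Type*} [Monoid M] [Monoid N] (f : M →* N) (a b : M) (n : ℕ) :
    f (alternatingProd a b n) = alternatingProd (f a) (f b) n := by
  induction n generalizing a b with
  | zero => exact map_one f
  | succ n ih => exact (map_mul f _ _).trans (by rw [ih]; rfl)

theorem commute_mul_pow_left_of_pow_eq {M : Type*} [Monoid M] {a b : M} {m : ℕ}
    (h : (a * b) ^ m = (b * a) ^ m) : Commute a ((a * b) ^ m) := by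
  have e : a * (b * a) ^ m = (a * b) ^ m * a := by
    induction m with
    | zero => simp
    | succ m _ => exact (SemiconjBy.pow_right (show SemiconjBy a (b * a) (a * b) by
        simp [SemiconjBy, mul_assoc]) _)
  exact (h ▸ e : a * (a * b) ^ m = (a * b) ^ m * a)

namespace LabelledGraph

variable {V : Type*} {Γ : LabelledGraph V}

theorem pow_half_label_eq (hΓ : Γ.IsEven) {u v : V} (h : Γ.graph.Adj u v) :
    (PresentedGroup.of u * PresentedGroup.of v : Γ.ArtinGroup) ^ (Γ.label s(u, v) / 2) =
      (PresentedGroup.of v * PresentedGroup.of u) ^ (Γ.label s(u, v) / 2) := by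
  have e := PresentedGroup.one_of_mem (rels := Γ.artinRelators) ⟨u, v, h, rfl⟩
  rw [map_mul, map_inv, mul_inv_eq_one, map_alternatingProd, map_alternatingProd,
    ← Nat.two_mul_div_two_of_even (hΓ _ h), alternatingProd_two_mul,
    alternatingProd_two_mul] at e
  exact e

theorem exists_vertexValue_ne_zero {χ : RealCharacter Γ.ArtinGroup} (hχ : χ ≠ 0) :
    ∃ v, Γ.vertexValue χ v ≠ 0 := by
  by_contra! h
  refine hχ (AddMonoidHom.ext fun g ↦ ?_)
  change χ.val (Additive.toMul g) = 0
  generalize Additive.toMul g = g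
  have hg : g ∈ Subgroup.closure
      (Set.range (PresentedGroup.of : V → Γ.ArtinGroup)) := by
    rw [PresentedGroup.closure_range_of]
    exact Subgroup.mem_top _
  induction hg using Subgroup.closure_induction with
  | mem x hx => obtain ⟨v, rfl⟩ := hx; exact h v
  | one => simp
  | mul x y _ _ hx hy => simp [hx, hy]
  | inv x _ hx => simp [hx]

theorem mem_verts_livingSubgraph {χ : RealCharacter Γ.ArtinGroup} {v : V} :
    v ∈ (Γ.livingSubgraph χ).verts ↔ Γ.vertexValue χ v ≠ 0 := by
  simp [livingSubgraph, fullLivingSubgraph]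

theorem livingSubgraph_adj {χ : RealCharacter Γ.ArtinGroup} {u v : V} :
    (Γ.livingSubgraph χ).Adj u v ↔ Γ.graph.Adj u v ∧ Γ.vertexValue χ u ≠ 0 ∧
      Γ.vertexValue χ v ≠ 0 ∧ s(u, v) ∉ Γ.deadEdges χ := by
  simp [livingSubgraph, fullLivingSubgraph, and_assoc]
  tauto

theorem mem_deadEdges (hΓ : Γ.IsEven) {χ : RealCharacter Γ.ArtinGroup} {u v : V}
    (h : Γ.graph.Adj u v) :
    s(u, v) ∈ Γ.deadEdges χ ↔ Γ.vertexValue χ u = -Γ.vertexValue χ v ∧ 2 < Γ.label s(u, v) := by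
  constructor
  · rintro ⟨a, b, e, -, hab, -, hl⟩
    refine ⟨?_, hl⟩
    rcases Sym2.eq_iff.1 e with ⟨rfl, rfl⟩ | ⟨rfl, rfl⟩
    · exact hab
    · rw [hab, neg_neg]
  · rintro ⟨h₁, h₂⟩
    exact ⟨u, v, rfl, h, h₁, hΓ _ h, h₂⟩

/-- The easy half of the description of `Σ¹`: a connected dominant living subgraph suffices. -/
theorem hasConnectedHalfCayley_of_livingSubgraph [Finite V] (hΓ : Γ.IsEven)
    {χ : RealCharacter Γ.ArtinGroup} (hconn : (Γ.livingSubgraph χ).Connected)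
    (hdom : Γ.IsDominant (Γ.livingSubgraph χ)) : HasConnectedHalfCayley χ := by
  classical
  have := Fintype.ofFinite V
  let gen : V → Γ.ArtinGroup := PresentedGroup.of
  let z : V → V → Γ.ArtinGroup := fun u v ↦ (gen u * gen v) ^ (Γ.label s(u, v) / 2)
  have zχ : ∀ u v, χ.val (z u v) =
      ((Γ.label s(u, v) / 2 : ℕ) : ℝ) * (Γ.vertexValue χ u + Γ.vertexValue χ v) := by
    intro u v
    simp [z, gen, vertexValue]
  have half_pos : ∀ {u v}, Γ.graph.Adj u v → ((Γ.label s(u, v) / 2 : ℕ) : ℝ) ≠ 0 := by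
    intro u v h
    have := Γ.two_le_label s(u, v) h
    exact Nat.cast_ne_zero.2 (by omega)
  have zleft : ∀ {u v}, Γ.graph.Adj u v → Commute (gen u) (z u v) := fun h ↦
    commute_mul_pow_left_of_pow_eq (pow_half_label_eq hΓ h)
  have zright : ∀ {u v}, Γ.graph.Adj u v → Commute (gen v) (z u v) := by
    intro u v h
    have e := pow_half_label_eq hΓ h
    have := commute_mul_pow_left_of_pow_eq e.symm
    rwa [← e] at this
  let S : Finset Γ.ArtinGroup := Finset.univ.image gen
  let T : Finset Γ.ArtinGroup := (S ∪ (Finset.univ.filter fun e : V × V ↦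
    Γ.graph.Adj e.1 e.2).image fun e ↦ z e.1 e.2).filter fun t ↦ χ.val t ≠ 0
  have gen_mem : ∀ {v}, Γ.vertexValue χ v ≠ 0 → gen v ∈ T := fun {v} hv ↦
    Finset.mem_filter.2 ⟨Finset.mem_union_left _ (Finset.mem_image_of_mem _ (Finset.mem_univ v)),
      hv⟩
  have z_mem : ∀ {u v}, Γ.graph.Adj u v → Γ.vertexValue χ u + Γ.vertexValue χ v ≠ 0 →
      z u v ∈ T := fun {u v} h hχ ↦
    Finset.mem_filter.2 ⟨Finset.mem_union_right _ (Finset.mem_image.2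
      ⟨(u, v), by simpa using h, rfl⟩), by rw [zχ]; exact mul_ne_zero (half_pos h) hχ⟩
  let R : Γ.ArtinGroup → Γ.ArtinGroup → Prop := fun x y ↦ y ∈ T ∧ Commute x y
  have step : ∀ {u v}, (Γ.livingSubgraph χ).Adj u v → Relation.ReflTransGen R (gen u) (gen v) := by
    intro u v h
    rw [livingSubgraph_adj] at h
    obtain ⟨h, hu, hv, hdead⟩ := h
    -- If the values cancel, `z u v` is useless, but the edge is not dead, so its label is 2 and its
    -- ends commute.
    by_cases hs : Γ.vertexValue χ u + Γ.vertexValue χ v = 0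
    · have hl : Γ.label s(u, v) = 2 := by
        have h₁ := Γ.two_le_label s(u, v) h
        have h₂ := mt (mem_deadEdges hΓ h).2 hdead
        have h₃ := eq_neg_of_add_eq_zero_left hs
        have : ¬ 2 < Γ.label s(u, v) := fun h₄ ↦ h₂ ⟨h₃, h₄⟩
        omega
      refine .single ⟨gen_mem hv, ?_⟩
      have e := pow_half_label_eq hΓ h
      rwa [hl, Nat.div_self two_pos, pow_one, pow_one] at e
    · exact (Relation.ReflTransGen.single ⟨z_mem h hs, zleft h⟩).tail
        ⟨gen_mem hv, (zright h).symm⟩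
  have gens : ∀ u v, Γ.vertexValue χ u ≠ 0 → Γ.vertexValue χ v ≠ 0 →
      Relation.ReflTransGen R (gen u) (gen v) := by
    intro u v hu hv
    obtain ⟨p⟩ := hconn.preconnected ⟨u, mem_verts_livingSubgraph.2 hu⟩
      ⟨v, mem_verts_livingSubgraph.2 hv⟩
    have key : ∀ {a b : (Γ.livingSubgraph χ).verts} (_ : (Γ.livingSubgraph χ).coe.Walk a b),
        Relation.ReflTransGen R (gen a) (gen b) := by
      intro a b p
      induction p with
      | nil => exact .refl
      | cons h _ ih => exact (step h).trans ih
    exact key p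
  have near : ∀ t ∈ T, ∃ v, Γ.vertexValue χ v ≠ 0 ∧ Commute t (gen v) := by
    intro t ht
    obtain ⟨ht, htχ⟩ := Finset.mem_filter.1 ht
    rcases Finset.mem_union.1 ht with ht | ht
    · obtain ⟨v, -, rfl⟩ := Finset.mem_image.1 ht
      exact ⟨v, htχ, .refl _⟩
    · obtain ⟨⟨u, v⟩, he, rfl⟩ := Finset.mem_image.1 ht
      have h : Γ.graph.Adj u v := (Finset.mem_filter.1 he).2
      by_cases hu : Γ.vertexValue χ u = 0
      · refine ⟨v, fun hv ↦ htχ ?_, (zright h).symm⟩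
        rw [zχ, hu, hv]
        simp
      · exact ⟨u, hu, (zleft h).symm⟩
  refine hasConnectedHalfCayley_of_commute χ S T ?_ ?_ (fun t ht ↦ (Finset.mem_filter.1 ht).2)
    ?_ ?_
  · simp [S, gen]
  · obtain ⟨v, hv⟩ := hconn.nonempty
    exact ⟨_, gen_mem (mem_verts_livingSubgraph.1 hv)⟩
  · intro t ht u hu
    obtain ⟨a, ha, hta⟩ := near t ht
    obtain ⟨b, hb, hub⟩ := near u hu
    exact ((Relation.ReflTransGen.single ⟨gen_mem ha, hta⟩).trans (gens a b ha hb)).tail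
      ⟨hu, hub.symm⟩
  · intro s hs
    obtain ⟨v, -, rfl⟩ := Finset.mem_image.1 hs
    by_cases hv : Γ.vertexValue χ v = 0
    · obtain ⟨w, hw, h⟩ := hdom v fun h ↦ mem_verts_livingSubgraph.1 h hv
      refine ⟨_, z_mem h ?_, zleft h⟩
      rw [hv, zero_add]
      exact mem_verts_livingSubgraph.1 hw
    · exact ⟨_, gen_mem hv, .refl _⟩

end LabelledGraph

/-! ### Vertex weights on forests -/

namespace SimpleGraph

variable {V : Type*} {D : SimpleGraph V} {M : Type*} [CommGroup M]

/-- The alternating product of the edge weights along a walk. -/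
def Walk.alternatingWeight (w : Sym2 V → M) :
    ∀ {u v : V}, D.Walk u v → M
  | _, _, .nil => 1
  | u, _, .cons (v := v) _ p => w s(u, v) / p.alternatingWeight w

/-- In a forest, one of the two paths to `r` is the other one preceded by the edge `uv`, so the
recursion for the weight applies. -/
theorem IsAcyclic.alternatingWeight_mul (hD : D.IsAcyclic) (w : Sym2 V → M) {u v r : V}
    (h : D.Adj u v) {p : D.Walk u r} {q : D.Walk v r} (hp : p.IsPath) (hq : q.IsPath) :
    p.alternatingWeight w * q.alternatingWeight w = w s(u, v) := by
  have aux : ∀ {a b : V} (hab : D.Adj a b) {p' : D.Walk a r} {q' : D.Walk b r},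
      p'.IsPath → q'.IsPath → b ∈ p'.support → p' = .cons hab q' := by
    intro a b hab p' q' hp' hq' hb
    have e := hD.path_concat hq'.reverse hp'.reverse hab.symm (by simpa using hb)
    simpa using congrArg Walk.reverse e
  by_cases hu : u ∈ q.support
  · rw [aux h.symm hq hp hu, Walk.alternatingWeight, Sym2.eq_swap]
    exact mul_div_cancel _ _
  · have e : p = .cons h q := congrArg Subtype.val <| (hD.subsingleton_path u r).elim
      ⟨p, hp⟩ ⟨.cons h q, (Walk.cons_isPath_iff h q).2 ⟨hq, hu⟩⟩
    rw [e, Walk.alternatingWeight]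
    exact div_mul_cancel _ _

/-- On a forest, vertex weights can be chosen so that the products over the edges are as
prescribed. -/
theorem IsAcyclic.exists_vertexWeight (hD : D.IsAcyclic) (w : Sym2 V → M) :
    ∃ l : V → M, ∀ u v, D.Adj u v → l u * l v = w s(u, v) := by
  have root : ∀ v, ∃ p : D.Walk v (D.connectedComponentMk v).out, p.IsPath := fun v ↦
    (ConnectedComponent.exact
      (Quot.out_eq (D.connectedComponentMk v))).symm.exists_isPath
  choose p hp using root
  refine ⟨fun v ↦ (p v).alternatingWeight w, fun u v h ↦ ?_⟩
  have hq : ∃ q : D.Walk v (D.connectedComponentMk u).out, q.IsPath ∧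
      q.alternatingWeight w = (p v).alternatingWeight w := by
    rw [ConnectedComponent.connectedComponentMk_eq_of_adj h]
    exact ⟨p v, hp v, rfl⟩
  obtain ⟨q, hq, e⟩ := hq
  change (p u).alternatingWeight w * (p v).alternatingWeight w = _
  rw [← e]
  exact hD.alternatingWeight_mul w h (hp u) hq

end SimpleGraph

/-- Stated for every `m`, so that a root can be chosen for all labels at once. -/
theorem Complex.exists_unit_pow_eq_one (m : ℕ) : ∃ z : ℂˣ, z ^ m = 1 ∧ (2 ≤ m → z ≠ 1) := by
  by_cases hm : 2 ≤ m
  · have h := Complex.isPrimitiveRoot_exp m (by omega)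
    obtain ⟨z, hz⟩ := h.isUnit (by omega)
    refine ⟨z, Units.ext (by rw [Units.val_pow_eq_pow_val, hz, h.pow_eq_one]; rfl), fun _ e ↦ ?_⟩
    refine h.ne_one hm ?_
    rw [← hz, e, Units.val_one]
  · exact ⟨1, one_pow m, fun h ↦ absurd h hm⟩

/-! ### Twisted homotheties of the function space -/

section Homothety

/-- The permutation of the space of functions `ℝ → ℂ` which fixes `q` and whose linear part is the
shift by `r` followed by the multiplication by `z`. -/
def homothety (q : ℝ → ℂ) (r : ℝ) (z : ℂˣ) : Equiv.Perm (ℝ → ℂ) where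
  toFun y x := q x + z * (y (x - r) - q (x - r))
  invFun y x := q x + (z⁻¹ : ℂˣ) * (y (x + r) - q (x + r))
  left_inv y := by ext x; simp
  right_inv y := by ext x; simp

theorem homothety_apply (q : ℝ → ℂ) (r : ℝ) (z : ℂˣ) (y : ℝ → ℂ) (x : ℝ) :
    homothety q r z y x = q x + z * (y (x - r) - q (x - r)) := rfl

theorem homothety_inv_apply (q : ℝ → ℂ) (r : ℝ) (z : ℂˣ) (y : ℝ → ℂ) (x : ℝ) :
    (homothety q r z)⁻¹ y x = q x + (z⁻¹ : ℂˣ) * (y (x + r) - q (x + r)) := rfl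

theorem homothety_mul (q : ℝ → ℂ) (r s : ℝ) (z w : ℂˣ) :
    homothety q r z * homothety q s w = homothety q (r + s) (z * w) := by
  ext y x
  simp only [Equiv.Perm.mul_apply, homothety_apply, Units.val_mul, sub_sub]
  ring

theorem homothety_zero_one (q : ℝ → ℂ) : homothety q 0 1 = 1 := by
  ext y x
  simp [homothety_apply]

theorem homothety_inv (q : ℝ → ℂ) (r : ℝ) (z : ℂˣ) :
    (homothety q r z)⁻¹ = homothety q (-r) z⁻¹ := by
  rw [inv_eq_iff_mul_eq_one, homothety_mul, add_neg_cancel, mul_inv_cancel, homothety_zero_one]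

theorem homothety_pow (q : ℝ → ℂ) (r : ℝ) (z : ℂˣ) (n : ℕ) :
    homothety q r z ^ n = homothety q (n * r) (z ^ n) := by
  induction n with
  | zero => simp [homothety_zero_one]
  | succ n ih =>
    rw [pow_succ, ih, homothety_mul, pow_succ]
    push_cast
    ring_nf

theorem homothety_commute (q : ℝ → ℂ) (r s : ℝ) (z w : ℂˣ) :
    Commute (homothety q r z) (homothety q s w) := by
  rw [Commute, SemiconjBy, homothety_mul, homothety_mul, add_comm, mul_comm]

/-- As `z ≠ 1`, `f` is the homothety of ratio `z` about its fixed point `c / (1 - z)`. -/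
theorem Equiv.Perm.pow_eq_one_of_affine {f : Equiv.Perm (ℝ → ℂ)} {z : ℂ} {c : ℝ → ℂ} {m : ℕ}
    (hf : ∀ y x, f y x = z * y x + c x) (hz : z ^ m = 1) (hz1 : z ≠ 1) : f ^ m = 1 := by
  have h1 : (1 - z) ≠ 0 := sub_ne_zero.2 hz1.symm
  have key : ∀ (n : ℕ) y x, (f ^ n) y x = z ^ n * (y x - c x / (1 - z)) + c x / (1 - z) := by
    intro n
    induction n with
    | zero => simp
    | succ n ih =>
      intro y x
      rw [pow_succ', Equiv.Perm.mul_apply, hf, ih]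
      field_simp
      ring
  ext y x
  rw [key, hz]
  simp

/-- Opposite shifts cancel, so the product acts pointwise with ratio `z * w`, even though the
centres differ. -/
theorem homothety_mul_homothety_pow_eq_one (q q' : ℝ → ℂ) (r s : ℝ) (z w : ℂˣ) {m : ℕ}
    (hrs : r + s = 0) (hz : (z * w) ^ m = 1) (hz1 : z * w ≠ 1) :
    (homothety q r z * homothety q' s w) ^ m = 1 := by
  refine Equiv.Perm.pow_eq_one_of_affine (z := (z * w : ℂˣ))
    (c := fun x ↦ q x + z * (q' (x - r) - w * q' x - q (x - r))) (fun y x ↦ ?_) ?_ ?_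
  · simp only [Equiv.Perm.mul_apply, homothety_apply, sub_sub, hrs, sub_zero, Units.val_mul]
    ring
  · rw [← Units.val_pow_eq_pow_val, hz, Units.val_one]
  · rwa [Ne, Units.val_eq_one]

end Homothety

/-! ### Actions that obstruct connectedness -/

section Obstruction

/-- A permutation of the space of functions `ℝ → ℂ` which is the shift by `r`, scaled, plus a
function supported on a half line `[C, ∞)`. -/
def IsShiftAffine (f : Equiv.Perm (ℝ → ℂ)) (r : ℝ) : Prop :=
  ∃ (z : ℂ) (c : ℝ → ℂ), z ≠ 0 ∧ (∃ C : ℝ, ∀ x < C, c x = 0) ∧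
    ∀ y x, f y x = z * y (x - r) + c x

namespace IsShiftAffine

theorem one : IsShiftAffine 1 0 := ⟨1, 0, one_ne_zero, ⟨0, by simp⟩, by simp⟩

theorem mul {f g : Equiv.Perm (ℝ → ℂ)} {r s : ℝ} (hf : IsShiftAffine f r)
    (hg : IsShiftAffine g s) : IsShiftAffine (f * g) (r + s) := by
  obtain ⟨z, c, hz, ⟨C, hC⟩, hf⟩ := hf
  obtain ⟨w, d, hw, ⟨D, hD⟩, hg⟩ := hg
  refine ⟨z * w, fun x ↦ z * d (x - r) + c x, mul_ne_zero hz hw, ⟨min C (D + r), ?_⟩, ?_⟩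
  · intro x hx
    rw [lt_min_iff] at hx
    simp only
    rw [hC x hx.1, hD (x - r) (by linarith), mul_zero, add_zero]
  · intro y x
    rw [Equiv.Perm.mul_apply, hf, hg, sub_sub]
    ring

theorem inv {f : Equiv.Perm (ℝ → ℂ)} {r : ℝ} (hf : IsShiftAffine f r) :
    IsShiftAffine f⁻¹ (-r) := by
  obtain ⟨z, c, hz, ⟨C, hC⟩, hf⟩ := hf
  refine ⟨z⁻¹, fun x ↦ -(z⁻¹ * c (x + r)), inv_ne_zero hz, ⟨C - r, fun x hx ↦ ?_⟩, fun y x ↦ ?_⟩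
  · simp [hC (x + r) (by linarith)]
  · have h := hf (f⁻¹ y) (x + r)
    rw [← Equiv.Perm.mul_apply, mul_inv_cancel, Equiv.Perm.one_apply, add_sub_cancel_right] at h
    rw [sub_neg_eq_add, h]
    field_simp
    ring

theorem homothety {q : ℝ → ℂ} {C : ℝ} (hq : ∀ x < C, q x = 0) (r : ℝ) (z : ℂˣ) :
    IsShiftAffine (homothety q r z) r := by
  refine ⟨z, fun x ↦ q x - z * q (x - r), z.ne_zero, ⟨min C (C + r), fun x hx ↦ ?_⟩, fun y x ↦ ?_⟩
  · rw [lt_min_iff] at hx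
    simp only
    rw [hq x hx.1, hq (x - r) (by linarith), mul_zero, sub_zero]
  · rw [homothety_apply]
    ring

theorem addRight {q : ℝ → ℂ} {C : ℝ} (hq : ∀ x < C, q x = 0) :
    IsShiftAffine (Equiv.addRight q) 0 :=
  ⟨1, q, one_ne_zero, ⟨C, hq⟩, by simp⟩

end IsShiftAffine

variable {G : Type*} [Group G] {χ : RealCharacter G}

/-- If the half space of `χ` is connected, then the orbit of `0` under the half space has uniformly
bounded below support, for every action by shift-affine permutations with shifts given by `χ`. -/
theorem HasConnectedHalfCayley.exists_forall_eq_zero (h : HasConnectedHalfCayley χ)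
    (φ : G →* Equiv.Perm (ℝ → ℂ)) (hφ : ∀ g, IsShiftAffine (φ g) (χ.val g)) :
    ∃ C : ℝ, ∀ g, 0 ≤ χ.val g → ∀ x < C, φ g 0 x = 0 := by
  classical
  obtain ⟨S, -, hS⟩ := h
  have hC : ∀ g, ∃ C : ℝ, ∀ x < C, φ g 0 x = 0 := by
    intro g
    obtain ⟨z, c, -, ⟨C, hC⟩, e⟩ := hφ g
    exact ⟨C, fun x hx ↦ by simp [e, hC x hx]⟩
  choose C hC using hC
  obtain ⟨K, hK⟩ := (S.image C).bddBelow
  -- The two functions differ by the linear part of `φ g` applied to `φ s 0`; since `χ(g) ≥ 0`, this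
  -- shift does not lower the support.
  have step : ∀ g, ∀ s ∈ S, 0 ≤ χ.val g → ∀ x < K, φ (g * s) 0 x = φ g 0 x := by
    intro g s hs hg x hx
    obtain ⟨z, c, -, -, e⟩ := hφ g
    have hx' : x - χ.val g < C s := by linarith [hK (Finset.mem_coe.2 (Finset.mem_image_of_mem C hs))]
    rw [map_mul, Equiv.Perm.mul_apply, e, e 0, hC s _ hx']
    rfl
  refine ⟨K, fun g hg ↦ ?_⟩
  obtain ⟨p⟩ := hS.preconnected ⟨g, hg⟩ ⟨1, by simp⟩
  have key : ∀ {a b : {g : G | 0 ≤ χ.val g}}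
      (_ : ((SimpleGraph.mulCayley (S : Set G)).induce {g : G | 0 ≤ χ.val g}).Walk a b),
      ∀ x < K, φ a.1 0 x = φ b.1 0 x := by
    intro a b p
    induction p with
    | nil => exact fun _ _ ↦ rfl
    | @cons a b _ h _ ih =>
      intro x hx
      rw [← ih x hx]
      rw [SimpleGraph.induce_adj, SimpleGraph.mulCayley_adj'] at h
      obtain ⟨-, s, hs, h | h⟩ := h
      · rw [← h]
        exact (step _ s hs a.2 x hx).symm
      · rw [h]
        exact step _ s hs b.2 x hx
  intro x hx
  rw [key p x hx]
  simp

theorem exists_map_eq_homothety_lt (φ : G →* Equiv.Perm (ℝ → ℂ)) {a : G} {q : ℝ → ℂ} {r : ℝ}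
    {z : ℂˣ} (ha : φ a = homothety q r z) (hr : r ≠ 0) (N : ℝ) :
    ∃ g s w, φ g = homothety q s w ∧ s < N := by
  have neg : ∀ b r z, φ b = homothety q r z → r < 0 →
      ∃ g s w, φ g = homothety q s w ∧ s < N := by
    intro b r z hb hr
    have h := (tendsto_natCast_atTop_atTop (R := ℝ)).atTop_mul_const_of_neg hr
    obtain ⟨n, hn⟩ := (h.eventually_lt_atBot N).exists
    exact ⟨b ^ n, n * r, z ^ n, by rw [map_pow, hb, homothety_pow], hn⟩
  rcases hr.lt_or_gt with hr | hr
  · exact neg a r z ha hr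
  · exact neg a⁻¹ (-r) z⁻¹ (by rw [map_inv, ha, homothety_inv]) (by linarith)

theorem not_hasConnectedHalfCayley_of_homotheties (φ : G →* Equiv.Perm (ℝ → ℂ))
    (hφ : ∀ g, IsShiftAffine (φ g) (χ.val g)) {a b : G} {r s : ℝ} {z w : ℂˣ}
    (ha : φ a = homothety (Pi.single 0 1) r z) (hb : φ b = homothety 0 s w)
    (hr : r ≠ 0) (hs : s ≠ 0) : ¬ HasConnectedHalfCayley χ := by
  intro h
  obtain ⟨C, hC⟩ := h.exists_forall_eq_zero φ hφ
  obtain ⟨g, r, z, hg, hr⟩ := exists_map_eq_homothety_lt φ ha hr (min C 0)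
  obtain ⟨k, s, w, hk, hs⟩ := exists_map_eq_homothety_lt φ hb hs (min C 0)
  rw [lt_min_iff] at hr hs
  -- The commutator has character 0, but its image of `0` takes the value `z * w ≠ 0` at `r + s`,
  -- below the bound.
  have e := hC (g * k * g⁻¹ * k⁻¹) (by simp) (r + s) (by linarith)
  have h₁ : r + s ≠ 0 := by linarith
  simp only [map_mul, map_inv, hg, hk, Equiv.Perm.mul_apply, homothety_apply,
    homothety_inv_apply] at e
  simp [h₁, hr.2.ne, hs.2.ne, add_comm] at e

theorem not_hasConnectedHalfCayley_of_translation (φ : G →* Equiv.Perm (ℝ → ℂ))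
    (hφ : ∀ g, IsShiftAffine (φ g) (χ.val g)) {a b : G} {r : ℝ} {z : ℂˣ}
    (ha : φ a = Equiv.addRight (Pi.single 0 1)) (haχ : χ.val a = 0) (hb : φ b = homothety 0 r z)
    (hr : r ≠ 0) : ¬ HasConnectedHalfCayley χ := by
  intro h
  obtain ⟨C, hC⟩ := h.exists_forall_eq_zero φ hφ
  obtain ⟨g, r, z, hg, hr⟩ := exists_map_eq_homothety_lt φ hb hr C
  -- This conjugate is the translation by `z` times the delta function at `r`.
  have e := hC (g * a * g⁻¹) (by simp [haχ]) r hr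
  simp only [map_mul, map_inv, hg, ha, Equiv.Perm.mul_apply, homothety_apply, Equiv.coe_addRight,
    Pi.add_apply, homothety_inv_apply] at e
  simp at e

end Obstruction

/-! ### Necessity of dominance and connectedness -/

namespace LabelledGraph

variable {V : Type*} {Γ : LabelledGraph V}

theorem exists_artinGroup_hom (hΓ : Γ.IsEven) {H : Type*} [Group H] (f : V → H)
    (hf : ∀ u v, Γ.graph.Adj u v →
      (f u * f v) ^ (Γ.label s(u, v) / 2) = (f v * f u) ^ (Γ.label s(u, v) / 2)) :
    ∃ φ : Γ.ArtinGroup →* H, ∀ v, φ (PresentedGroup.of v) = f v := by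
  have h : ∀ r ∈ Γ.artinRelators, FreeGroup.lift f r = 1 := by
    rintro _ ⟨u, v, h, rfl⟩
    rw [map_mul, map_inv, mul_inv_eq_one, map_alternatingProd, map_alternatingProd,
      ← Nat.two_mul_div_two_of_even (hΓ _ h), alternatingProd_two_mul, alternatingProd_two_mul]
    simpa using hf u v h
  exact ⟨PresentedGroup.toGroup h, fun v ↦ PresentedGroup.toGroup.of h⟩

theorem isShiftAffine_of_generators {χ : RealCharacter Γ.ArtinGroup}
    (φ : Γ.ArtinGroup →* Equiv.Perm (ℝ → ℂ))
    (h : ∀ v, IsShiftAffine (φ (PresentedGroup.of v)) (Γ.vertexValue χ v)) (g : Γ.ArtinGroup) :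
    IsShiftAffine (φ g) (χ.val g) := by
  have hg : g ∈ Subgroup.closure (Set.range (PresentedGroup.of : V → Γ.ArtinGroup)) := by
    rw [PresentedGroup.closure_range_of]
    exact Subgroup.mem_top _
  induction hg using Subgroup.closure_induction with
  | mem x hx => obtain ⟨v, rfl⟩ := hx; exact h v
  | one => simpa using IsShiftAffine.one
  | mul x y _ _ hx hy => simpa using hx.mul hy
  | inv x _ hx => simpa using hx.inv

theorem single_eq_zero_of_neg : ∀ x < (0 : ℝ), (Pi.single 0 1 : ℝ → ℂ) x = 0 := fun _ hx ↦
  Pi.single_eq_of_ne hx.ne 1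

theorem isDominant_livingSubgraph_of_hasConnectedHalfCayley (hΓ : Γ.IsEven)
    {χ : RealCharacter Γ.ArtinGroup} (hχ : χ ≠ 0) (h : HasConnectedHalfCayley χ) :
    Γ.IsDominant (Γ.livingSubgraph χ) := by
  classical
  intro v hv
  rw [mem_verts_livingSubgraph, not_not] at hv
  by_contra! hnot
  have hnot : ∀ w, Γ.graph.Adj v w → Γ.vertexValue χ w = 0 := fun w hw ↦ by
    by_contra hw'
    exact hnot w (mem_verts_livingSubgraph.2 hw') hw
  obtain ⟨u, hu⟩ := exists_vertexValue_ne_zero hχ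
  -- All neighbours of `v` have character 0 and act trivially, so the translation at `v` respects
  -- every relation.
  let f : V → Equiv.Perm (ℝ → ℂ) := fun w ↦
    if w = v then Equiv.addRight (Pi.single 0 1) else homothety 0 (Γ.vertexValue χ w) 1
  have fv : f v = Equiv.addRight (Pi.single 0 1) := if_pos rfl
  have fne : ∀ {w}, w ≠ v → f w = homothety 0 (Γ.vertexValue χ w) 1 := fun hw ↦ if_neg hw
  have fone : ∀ {w}, Γ.graph.Adj v w → f w = 1 := fun {w} hw ↦ by
    rw [fne hw.ne', hnot w hw, homothety_zero_one]
  obtain ⟨φ, hφ⟩ := exists_artinGroup_hom hΓ f fun a b hab ↦ by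
    have hcomm : Commute (f a) (f b) := by
      by_cases ha : a = v
      · subst ha
        rw [fone hab]
        exact .one_right _
      · by_cases hb : b = v
        · subst hb
          rw [fone hab.symm]
          exact .one_left _
        · rw [fne ha, fne hb]
          exact homothety_commute ..
    rw [hcomm.eq]
  refine not_hasConnectedHalfCayley_of_translation φ (isShiftAffine_of_generators φ fun w ↦ ?_)
    ((hφ v).trans fv) hv ((hφ u).trans (fne fun e ↦ hu (e ▸ hv))) hu h
  rw [hφ]
  by_cases hw : w = v
  · subst hw
    rw [fv, hv]
    exact .addRight single_eq_zero_of_neg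
  · rw [fne hw]
    exact .homothety (C := 0) (by simp) _ _

/-- The graph of dead edges between vertices where `χ` does not vanish. -/
def deadGraph (χ : RealCharacter Γ.ArtinGroup) : SimpleGraph V where
  Adj u v := Γ.graph.Adj u v ∧ s(u, v) ∈ Γ.deadEdges χ ∧
    Γ.vertexValue χ u ≠ 0 ∧ Γ.vertexValue χ v ≠ 0
  symm.symm _ _ h := ⟨h.1.symm, Sym2.eq_swap ▸ h.2.1, h.2.2.2, h.2.2.1⟩
  loopless.irrefl _ h := h.1.ne rfl

/-- Dead edges reverse the sign of `χ`, so an odd cycle of them would force `χ` to vanish on it. -/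
theorem isAcyclic_deadGraph (hΓ : Γ.IsEven)
    (hodd : ∀ (v : V) (p : Γ.graph.Walk v v), p.IsCycle →
      (∀ e ∈ p.edges, 2 < Γ.label e) → Odd p.length) (χ : RealCharacter Γ.ArtinGroup) :
    (Γ.deadGraph χ).IsAcyclic := by
  intro v p hp
  have hle : Γ.deadGraph χ ≤ Γ.graph := fun _ _ h ↦ h.1
  have h := hodd v (p.mapLe hle) (hp.mapLe hle) fun e he ↦ by
    rw [SimpleGraph.Walk.edges_mapLe_eq_edges] at he
    obtain ⟨_, _, _, _, _, _, hl⟩ : e ∈ Γ.deadEdges χ := by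
      have := p.edges_subset_edgeSet he
      induction e with
      | _ a b => exact this.2.1
    exact hl
  have alternating : ∀ {a b} (q : (Γ.deadGraph χ).Walk a b),
      Γ.vertexValue χ b = (-1) ^ q.length * Γ.vertexValue χ a := by
    intro a b q
    induction q with
    | nil => simp
    | cons hadj q ih =>
      have := ((mem_deadEdges hΓ hadj.1).1 hadj.2.1).1
      rw [ih, SimpleGraph.Walk.length_cons, this, pow_succ]
      ring
  have e := alternating p
  rw [SimpleGraph.Walk.length_map] at h
  rw [h.neg_one_pow] at e
  have hv : Γ.vertexValue χ v ≠ 0 := (p.adj_snd hp.not_nil).2.2.1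
  exact hv (by linarith)

theorem connected_livingSubgraph_of_hasConnectedHalfCayley (hΓ : Γ.IsEven)
    (hodd : ∀ (v : V) (p : Γ.graph.Walk v v), p.IsCycle →
      (∀ e ∈ p.edges, 2 < Γ.label e) → Odd p.length)
    {χ : RealCharacter Γ.ArtinGroup} (hχ : χ ≠ 0) (h : HasConnectedHalfCayley χ) :
    (Γ.livingSubgraph χ).Connected := by
  classical
  obtain ⟨u, hu⟩ := exists_vertexValue_ne_zero hχ
  have : Nonempty (Γ.livingSubgraph χ).verts := ⟨⟨u, mem_verts_livingSubgraph.2 hu⟩⟩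
  refine ⟨⟨fun a b ↦ ?_⟩⟩
  by_contra hab
  -- `A` is the living component of `a`; an edge from it to a living vertex outside must be dead.
  let A : Set V := {v | ∃ hv, (Γ.livingSubgraph χ).coe.Reachable a ⟨v, hv⟩}
  have hA : ∀ {v}, v ∈ A → Γ.vertexValue χ v ≠ 0 := fun ⟨hv, _⟩ ↦ mem_verts_livingSubgraph.1 hv
  have ha : a.1 ∈ A := ⟨a.2, .refl _⟩
  have hb : b.1 ∉ A := fun ⟨_, hr⟩ ↦ hab hr
  have hcross : ∀ {u v}, Γ.graph.Adj u v → u ∈ A → v ∉ A → Γ.vertexValue χ v ≠ 0 →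
      (Γ.deadGraph χ).Adj u v := by
    intro u v huv hu hv hvχ
    refine ⟨huv, ?_, hA hu, hvχ⟩
    by_contra hd
    obtain ⟨hu', hr⟩ := hu
    refine hv ⟨mem_verts_livingSubgraph.2 hvχ, hr.trans (SimpleGraph.Adj.reachable ?_)⟩
    exact livingSubgraph_adj.2 ⟨huv, mem_verts_livingSubgraph.1 hu', hvχ, hd⟩
  choose root hroot hroot1 using Complex.exists_unit_pow_eq_one
  obtain ⟨l, hl⟩ := (isAcyclic_deadGraph hΓ hodd χ).exists_vertexWeight
    fun e ↦ root (Γ.label e / 2)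
  let f : V → Equiv.Perm (ℝ → ℂ) := fun v ↦
    if v ∈ A then homothety (Pi.single 0 1) (Γ.vertexValue χ v) (l v)
    else if Γ.vertexValue χ v = 0 then 1 else homothety 0 (Γ.vertexValue χ v) (l v)
  have fA : ∀ {v}, v ∈ A → f v = homothety (Pi.single 0 1) (Γ.vertexValue χ v) (l v) :=
    fun hv ↦ if_pos hv
  have fB : ∀ {v}, v ∉ A → Γ.vertexValue χ v ≠ 0 → f v = homothety 0 (Γ.vertexValue χ v) (l v) :=
    fun hv hv' ↦ (if_neg hv).trans (if_neg hv')
  have fone : ∀ {v}, Γ.vertexValue χ v = 0 → f v = 1 :=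
    fun hv ↦ (if_neg fun h ↦ hA h hv).trans (if_pos hv)
  have fdead : ∀ {u v} (q q' : ℝ → ℂ), (Γ.deadGraph χ).Adj u v →
      (homothety q (Γ.vertexValue χ u) (l u) * homothety q' (Γ.vertexValue χ v) (l v)) ^
        (Γ.label s(u, v) / 2) = 1 := by
    intro u v q q' huv
    obtain ⟨hχuv, hlabel⟩ := (mem_deadEdges hΓ huv.1).1 huv.2.1
    refine homothety_mul_homothety_pow_eq_one _ _ _ _ _ _ (by rw [hχuv, neg_add_cancel]) ?_ ?_
    · rw [hl u v huv, hroot]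
    · rw [hl u v huv]
      refine hroot1 _ ?_
      -- An even label above 2 is at least 4, so its half is at least 2 and the chosen root is not
      -- 1.
      obtain ⟨k, hk⟩ := hΓ s(u, v) huv.1
      omega
  obtain ⟨φ, hφ⟩ := exists_artinGroup_hom hΓ f fun u v huv ↦ by
    by_cases hu0 : Γ.vertexValue χ u = 0
    · rw [fone hu0, one_mul, mul_one]
    by_cases hv0 : Γ.vertexValue χ v = 0
    · rw [fone hv0, one_mul, mul_one]
    by_cases hu : u ∈ A <;> by_cases hv : v ∈ A
    · rw [fA hu, fA hv, (homothety_commute ..).eq]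
    · have hd := hcross huv hu hv hv0
      rw [fA hu, fB hv hv0, fdead _ _ hd, Sym2.eq_swap, fdead _ _ hd.symm]
    · have hd := hcross huv.symm hv hu hu0
      rw [fA hv, fB hu hu0, fdead _ _ hd.symm, Sym2.eq_swap, fdead _ _ hd]
    · rw [fB hu hu0, fB hv hv0, (homothety_commute ..).eq]
  have hbχ := mem_verts_livingSubgraph.1 b.2
  refine not_hasConnectedHalfCayley_of_homotheties φ (isShiftAffine_of_generators φ fun v ↦ ?_)
    ((hφ a).trans (fA ha)) ((hφ b).trans (fB hb hbχ)) (hA ha) hbχ h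
  rw [hφ]
  by_cases hv : v ∈ A
  · rw [fA hv]
    exact .homothety single_eq_zero_of_neg _ _
  by_cases hv0 : Γ.vertexValue χ v = 0
  · rw [fone hv0, hv0]
    exact .one
  · rw [fB hv hv0]
    exact .homothety (C := 0) (by simp) _ _

end LabelledGraph

theorem theoremA {V : Type*} [Finite V] (Γ : LabelledGraph V) (hΓ : Γ.IsEven)
    (hodd : ∀ (v : V) (p : Γ.graph.Walk v v), p.IsCycle →
      (∀ e ∈ p.edges, 2 < Γ.label e) → Odd p.length) :
    sigmaOne Γ.ArtinGroup =
      {c | ∃ (χ : RealCharacter Γ.ArtinGroup) (hχ : χ ≠ 0), c = rayOfNeZero ℝ χ hχ ∧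
        (Γ.livingSubgraph χ).Connected ∧ Γ.IsDominant (Γ.livingSubgraph χ)} := by
  ext c
  refine exists_congr fun χ ↦ exists_congr fun hχ ↦ and_congr_right fun _ ↦ ⟨fun h ↦ ⟨?_, ?_⟩, ?_⟩
  · exact LabelledGraph.connected_livingSubgraph_of_hasConnectedHalfCayley hΓ hodd hχ h
  · exact LabelledGraph.isDominant_livingSubgraph_of_hasConnectedHalfCayley hΓ hχ h
  · exact fun h ↦ LabelledGraph.hasConnectedHalfCayley_of_livingSubgraph hΓ h.1 h.2
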